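/- Let $n\ge 1$ and let $\triangle=\{(x_1,\dots,x_n)\in\mathbb R^n : 1\ge x_1\ge\cdots\ge x_n\ge 0\}$. For $b=0,1,2,\dots$ put $$\triangle_b=\{x\in\triangle : 1-x_1-bx_n\ge 0>1-x_1-(b+1)x_n\};$$ these sets partition $\{x\in\triangle : x_n>0\}$, which is almost all of $\triangle$. The (fast) triangle map $T:\triangle\to\triangle$ is $$T(x_1,\dots,x_n)=\left(\frac{x_2}{x_1},\dots,\frac{x_n}{x_1},\frac{1-x_1-bx_n}{x_1}\right)\qquad\text{for } x\in\triangle_b,$$ and, by convention, $T(x)=(0,\dots,0)$ on the null set $\{x\in\triangle : x_n=0\}$ (for $n=1$ this is the Gauss map). Then $T$ is ergodic with respect to Lebesgue measure $\lambda$ on $\triangle$: $T$ is measurable, $\lambda(T^{-1}(A))=0$ for every measurable $A\subseteq\triangle$ with $\lambda(A)=0$, and every measurable $A\subseteq\triangle$ with $T^{-1}(A)=A$ satisfies $\lambda(A)=0$ or $\lambda(\triangle\setminus A)=0$. -/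

import Mathlib

open MeasureTheory

namespace TriangleMap

/-- The simplex `{x ∈ ℝⁿ : 1 ≥ x₁ ≥ ⋯ ≥ xₙ ≥ 0}`; the coordinate `xᵢ₊₁` is `x i`. -/
def simplex (n : ℕ) : Set (Fin n → ℝ) :=
  {x | (∀ i, x i ≤ 1) ∧ Antitone x ∧ ∀ i, 0 ≤ x i}

/-- The piece `{x ∈ simplex : 1 - x₁ - b xₙ ≥ 0 > 1 - x₁ - (b + 1) xₙ}`, in dimension `m + 1`. -/
def piece (m b : ℕ) : Set (Fin (m + 1) → ℝ) :=
  {x | x ∈ simplex (m + 1) ∧ 0 ≤ 1 - x 0 - b * x (Fin.last m) ∧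
    1 - x 0 - (b + 1) * x (Fin.last m) < 0}

/-- The digit `b = ⌊(1 - x₁) / xₙ⌋`. -/
noncomputable def digit {m : ℕ} (x : Fin (m + 1) → ℝ) : ℕ :=
  ⌊(1 - x 0) / x (Fin.last m)⌋₊

/-- The formula `(x₂ / x₁, …, xₙ / x₁, (1 - x₁ - b xₙ) / x₁)` in dimension `n = m + 1`. -/
noncomputable def branch {m : ℕ} (b : ℕ) (x : Fin (m + 1) → ℝ) : Fin (m + 1) → ℝ :=
  Fin.snoc (α := fun _ => ℝ) (fun i : Fin m => x i.succ / x 0)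
    ((1 - x 0 - b * x (Fin.last m)) / x 0)

/-- The pieces partition the part of the simplex where the last coordinate is nonzero,
and on it the piece containing `x` is the one indexed by `digit x`. -/
theorem mem_piece_iff {m b : ℕ} {x : Fin (m + 1) → ℝ} :
    x ∈ piece m b ↔ x ∈ simplex (m + 1) ∧ x (Fin.last m) ≠ 0 ∧ digit x = b := by
  constructor
  · rintro ⟨hx, h1, h2⟩
    have h0 : x (Fin.last m) ≠ 0 := by
      intro h
      rw [h] at h1 h2
      linarith
    have hp : 0 < x (Fin.last m) := lt_of_le_of_ne (hx.2.2 _) h0.symm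
    refine ⟨hx, h0, ?_⟩
    rw [digit, Nat.floor_eq_iff (div_nonneg (by linarith [hx.1 0]) hp.le), le_div_iff₀ hp,
      div_lt_iff₀ hp]
    constructor <;> linarith
  · rintro ⟨hx, h0, hb⟩
    have hp : 0 < x (Fin.last m) := lt_of_le_of_ne (hx.2.2 _) h0.symm
    rw [digit, Nat.floor_eq_iff (div_nonneg (by linarith [hx.1 0]) hp.le), le_div_iff₀ hp,
      div_lt_iff₀ hp] at hb
    exact ⟨hx, by linarith [hb.1], by linarith [hb.2]⟩

theorem branch_mem_simplex {m b : ℕ} {x : Fin (m + 1) → ℝ} (hx : x ∈ piece m b) :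
    branch b x ∈ simplex (m + 1) := by
  have h0 := (mem_piece_iff.1 hx).2.1
  obtain ⟨⟨h1, ha, hn⟩, hb1, hb2⟩ := hx
  have hl : 0 < x (Fin.last m) := lt_of_le_of_ne (hn _) h0.symm
  have hp : 0 < x 0 := hl.trans_le (ha (Fin.zero_le _))
  have hlast : (1 - x 0 - b * x (Fin.last m)) / x 0 ≤ x (Fin.last m) / x 0 := by
    gcongr
    linarith
  refine ⟨fun i => ?_, fun i j hij => ?_, fun i => ?_⟩
  · induction i using Fin.lastCases with
    | last =>
      simp only [branch, Fin.snoc_last]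
      exact hlast.trans ((div_le_one hp).2 (ha (Fin.zero_le _)))
    | cast i =>
      simp only [branch, Fin.snoc_castSucc]
      exact (div_le_one hp).2 (ha (Fin.zero_le _))
  · induction j using Fin.lastCases with
    | last =>
      induction i using Fin.lastCases with
      | last => exact le_rfl
      | cast i =>
        simp only [branch, Fin.snoc_last, Fin.snoc_castSucc]
        refine hlast.trans ?_
        gcongr
        exact ha (Fin.le_last _)
    | cast j =>
      induction i using Fin.lastCases with
      | last => exact absurd hij (not_le.2 (Fin.castSucc_lt_last j))
      | cast i =>
        simp only [branch, Fin.snoc_castSucc]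
        gcongr
        exact ha (Fin.succ_le_succ_iff.2 (Fin.castSucc_le_castSucc_iff.1 hij))
  · induction i using Fin.lastCases with
    | last =>
      simp only [branch, Fin.snoc_last]
      exact div_nonneg hb1 hp.le
    | cast i =>
      simp only [branch, Fin.snoc_castSucc]
      exact div_nonneg (hn _) hp.le

theorem zero_mem_simplex (n : ℕ) : (0 : Fin n → ℝ) ∈ simplex n :=
  ⟨fun _ => zero_le_one, fun _ _ _ => le_rfl, fun _ => le_rfl⟩

open Classical in
/-- The (fast) triangle map on the simplex of dimension `m + 1`: on the piece with digit `b` it is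
`branch b`. The face `xₙ = 0`, a null set which meets no piece, is sent to the origin
(as is customary for the Gauss map, the case of dimension one). -/
noncomputable def triangleMap (m : ℕ) (x : simplex (m + 1)) : simplex (m + 1) :=
  if h : x.1 (Fin.last m) = 0 then ⟨0, zero_mem_simplex _⟩
  else ⟨branch (digit x.1) x.1, branch_mem_simplex (mem_piece_iff.2 ⟨x.2, h, rfl⟩)⟩

end TriangleMap

/-!
In the homogeneous coordinates `yᵢ = xᵢ - xᵢ₊₁` (with `x₀ = 1` and `xₙ₊₁ = 0`) the simplex is the
projectivized positive orthant, and the inverse branches of the triangle map are nonnegative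
integer matrices of determinant `± 1`. The cylinder of a word is the image of the orthant under a
product `W` of such matrices, and its measure is governed by the column sums of `W`.

Whatever the digits read so far, the next one is "tame", that is, at most the ratio of the last to
the first column sum, with conditional probability at least `1 / 2`. After `m + 1` consecutive tame
digits the column sums agree up to the constant `3 ^ (m + 1)`, and the projective oscillation of
the cylinder has shrunk by a fixed factor. Hence almost every point lies in arbitrarily small
cylinders with comparable column sums. On such a cylinder the map has bounded distortion, so an
invariant set of positive measure fills a definite proportion of it; a density argument then shows
that its complement is null.
-/

namespace TriangleMap

open Set Matrix Filter Topology
open scoped ENNReal Pointwise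

section CantorScheme

/-! ### Measures on Cantor schemes -/

variable {α β : Type*} {A : List β → Set α}

theorem cantorScheme_append_subset (hA : CantorScheme.Antitone A) (u l : List β) :
    A (u ++ l) ⊆ A l := by
  induction u with
  | nil => exact Subset.rfl
  | cons b u ih => exact (hA _ b).trans ih

theorem suffix_or_suffix_of_mem (hA : CantorScheme.Antitone A) (hd : CantorScheme.Disjoint A)
    {x : α} {l l' : List β} (hx : x ∈ A l) (hx' : x ∈ A l') : l <:+ l' ∨ l' <:+ l := by
  induction l with
  | nil => exact Or.inl (List.nil_suffix)
  | cons b l ih =>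
    rcases ih (hA l b hx) with ⟨u, rfl⟩ | h
    · rcases List.eq_nil_or_concat' u with rfl | ⟨u, c, rfl⟩
      · exact Or.inr (List.suffix_cons b l)
      · rw [List.append_assoc, List.singleton_append] at hx' ⊢
        have hbc : b = c := by
          by_contra hne
          exact disjoint_left.1 (hd l hne) hx (cantorScheme_append_subset hA u _ hx')
        exact Or.inl ⟨u, by rw [hbc]⟩
    · exact Or.inr (h.trans (List.suffix_cons b l))

theorem exists_subset_pairwiseDisjoint_biUnion_eq (hA : CantorScheme.Antitone A)
    (hd : CantorScheme.Disjoint A) (G : Set (List β)) :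
    ∃ G' ⊆ G, G'.PairwiseDisjoint A ∧ ⋃ l ∈ G', A l = ⋃ l ∈ G, A l := by
  refine ⟨{l ∈ G | ∀ g ∈ G, g <:+ l → g = l}, fun l hl => hl.1, ?_, ?_⟩
  · refine fun l hl l' hl' hne => disjoint_left.2 fun x hx hx' => ?_
    rcases suffix_or_suffix_of_mem hA hd hx hx' with h | h
    · exact hne (hl'.2 l hl.1 h)
    · exact hne (hl.2 l' hl'.1 h).symm
  · refine Subset.antisymm (biUnion_subset_biUnion_left fun l hl => hl.1)
      (iUnion₂_subset fun l hl => ?_)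
    obtain ⟨g, ⟨hgG, u, rfl⟩, hmin⟩ := (measure List.length).wf.has_min {g ∈ G | g <:+ l}
      ⟨l, hl, List.suffix_rfl⟩
    refine (cantorScheme_append_subset hA u g).trans (subset_biUnion_of_mem (u := A) ⟨hgG, ?_⟩)
    intro g' hg' hs
    exact hs.eq_of_length_le (not_lt.1 (hmin g' ⟨hg', hs.trans ⟨u, rfl⟩⟩))

/-- The part of the `k`-th level of the scheme `A` made of the sets whose word has no ancestor
in `G`: what remains to be covered by `G` after `k` steps. -/
def residual (A : List β → Set α) (G : Set (List β)) (k : ℕ) : Set α :=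
  ⋃ l ∈ {l : List β | l.length = k ∧ ∀ g ∈ G, ¬ g <:+ l}, A l

theorem antitone_residual (hA : CantorScheme.Antitone A) (G : Set (List β)) :
    Antitone (residual A G) := by
  refine antitone_nat_of_succ_le fun k => iUnion₂_subset ?_
  rintro (_ | ⟨b, l⟩) ⟨hk, hG⟩
  · simp at hk
  · exact (hA l b).trans (subset_biUnion_of_mem (u := A)
      ⟨by simpa using hk, fun g hg h => hG g hg (h.trans (List.suffix_cons b l))⟩)

theorem disjoint_biUnion_iInter_residual (hA : CantorScheme.Antitone A)
    (hd : CantorScheme.Disjoint A) (G : Set (List β)) :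
    Disjoint (⋃ g ∈ G, A g) (⋂ k, residual A G k) := by
  refine disjoint_left.2 fun x hx hx' => ?_
  obtain ⟨g, hg, hxg⟩ := mem_iUnion₂.1 hx
  obtain ⟨l, ⟨hl, hlG⟩, hxl⟩ := mem_iUnion₂.1 (mem_iInter.1 hx' g.length)
  rcases suffix_or_suffix_of_mem hA hd hxg hxl with h | h
  · exact hlG g hg h
  · exact hlG g hg (h.eq_of_length hl ▸ List.suffix_rfl)

variable [MeasurableSpace α] {μ : Measure α}

theorem mul_measure_biUnion_le [Countable β] (hA : CantorScheme.Antitone A)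
    (hd : CantorScheme.Disjoint A) (hm : ∀ l, MeasurableSet (A l)) {E : Set α}
    (hE : MeasurableSet E) {a K : ℝ≥0∞} {G : Set (List β)}
    (h : ∀ l ∈ G, a * μ (A l) ≤ K * μ (E ∩ A l)) :
    a * μ (⋃ l ∈ G, A l) ≤ K * μ (E ∩ ⋃ l ∈ G, A l) := by
  obtain ⟨G', hG', hdisj, hU⟩ := exists_subset_pairwiseDisjoint_biUnion_eq hA hd G
  rw [← hU, inter_iUnion₂, measure_biUnion (to_countable G') hdisj fun l _ => hm l,
    measure_biUnion (to_countable G') (hdisj.mono fun l => inter_subset_right)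
      fun l _ => hE.inter (hm l), ← ENNReal.tsum_mul_left, ← ENNReal.tsum_mul_left]
  exact ENNReal.tsum_le_tsum fun l => h l (hG' l.2)

theorem measurableSet_residual [Countable β] (hm : ∀ l, MeasurableSet (A l)) (G : Set (List β))
    (k : ℕ) : MeasurableSet (residual A G k) :=
  .biUnion (to_countable _) fun l _ => hm l

theorem ae_mem_residual_or_mem_biUnion [Countable β] (hA : CantorScheme.Antitone A)
    (hc : ∀ l, ∀ᵐ x ∂μ, x ∈ A l → ∃ b, x ∈ A (b :: l)) (G : Set (List β)) (k : ℕ) :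
    ∀ᵐ x ∂μ, x ∈ A [] → x ∈ residual A G k ∨ x ∈ ⋃ g ∈ G, A g := by
  have hlevel : ∀ᵐ x ∂μ, x ∈ A [] → ∃ l : List β, l.length = k ∧ x ∈ A l := by
    induction k with
    | zero => exact .of_forall fun x hx => ⟨[], rfl, hx⟩
    | succ k ih =>
      filter_upwards [ih, ae_all_iff.2 hc] with x hx hx' h0
      obtain ⟨l, rfl, hl⟩ := hx h0
      obtain ⟨b, hb⟩ := hx' l hl
      exact ⟨b :: l, rfl, hb⟩
  filter_upwards [hlevel] with x hx h0
  obtain ⟨l, hl, hxl⟩ := hx h0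
  by_cases h : ∃ g ∈ G, g <:+ l
  · obtain ⟨g, hg, u, rfl⟩ := h
    exact Or.inr (mem_biUnion hg (cantorScheme_append_subset hA u g hxl))
  · exact Or.inl (mem_biUnion (show l ∈ {l | _ ∧ _} from ⟨hl, by simpa using h⟩) hxl)

theorem ae_exists_mem_of_forall_mul_le [Countable β] [IsFiniteMeasure μ]
    (hA : CantorScheme.Antitone A) (hd : CantorScheme.Disjoint A) (hm : ∀ l, MeasurableSet (A l))
    (hc : ∀ l, ∀ᵐ x ∂μ, x ∈ A l → ∃ b, x ∈ A (b :: l)) {δ : ℝ≥0∞} (hδ : δ ≠ 0)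
    {G : Set (List β)} (hG : ∀ l, δ * μ (A l) ≤ μ ((⋃ g ∈ G, A g) ∩ A l)) :
    ∀ᵐ x ∂μ, x ∈ A [] → ∃ g ∈ G, x ∈ A g := by
  set E := ⋃ g ∈ G, A g
  have hEm : MeasurableSet E := .biUnion (to_countable _) fun l _ => hm l
  have hRm (k : ℕ) : NullMeasurableSet (E ∩ residual A G k) μ :=
    (hEm.inter (measurableSet_residual hm G k)).nullMeasurableSet
  have hle (k : ℕ) : δ * μ (⋂ k, residual A G k) ≤ μ (E ∩ residual A G k) := calc
    δ * μ (⋂ k, residual A G k) ≤ δ * μ (residual A G k) := by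
      gcongr
      exact iInter_subset _ k
    _ ≤ 1 * μ (E ∩ residual A G k) :=
      mul_measure_biUnion_le hA hd hm hEm fun l _ => by simpa using hG l
    _ = μ (E ∩ residual A G k) := one_mul _
  have hlim : Tendsto (fun k => μ (E ∩ residual A G k)) atTop (𝓝 0) := by
    have h := tendsto_measure_iInter_atTop hRm
      (fun i j hij => inter_subset_inter_right E (antitone_residual hA G hij))
      ⟨0, measure_ne_top μ _⟩
    rwa [← inter_iInter, (disjoint_biUnion_iInter_residual hA hd G).inter_eq, measure_empty] at h
  have hzero : μ (⋂ k, residual A G k) = 0 :=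
    (mul_eq_zero.1 (nonpos_iff_eq_zero.1 (ge_of_tendsto' hlim hle))).resolve_left hδ
  filter_upwards [measure_eq_zero_iff_ae_notMem.1 hzero,
    ae_all_iff.2 (ae_mem_residual_or_mem_biUnion hA hc G)] with x hx hcover h0
  obtain ⟨k, hk⟩ := not_forall.1 (mt mem_iInter.2 hx)
  simpa using (hcover k h0).resolve_left hk

/-- This is the Lebesgue density argument: the sets `A l` with `l ∈ G` play the role of the small
balls, and each of them meets `π ⁻¹' F` in a definite proportion of its measure. -/
theorem measure_preimage_eq_zero_or_compl [Countable β] [IsFiniteMeasure μ]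
    (hA : CantorScheme.Antitone A) (hd : CantorScheme.Disjoint A) (hm : ∀ l, MeasurableSet (A l))
    {Y : Type*} [PseudoMetricSpace Y] [MeasurableSpace Y] [BorelSpace Y] {π : α → Y}
    (hπ : Measurable π) {F : Set Y} (hF : MeasurableSet F) {K : ℝ≥0∞} (hK : K ≠ ∞)
    {G : Set (List β)} (hG : ∀ l ∈ G, μ (π ⁻¹' F) * μ (A l) ≤ K * μ (π ⁻¹' F ∩ A l))
    (hae : ∀ᵐ x ∂μ, ∀ ε > 0, ∃ l ∈ G, x ∈ A l ∧ MapsTo π (A l) (Metric.ball (π x) ε)) :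
    μ (π ⁻¹' F) = 0 ∨ μ (π ⁻¹' F)ᶜ = 0 := by
  suffices h : ∀ ε : ℝ≥0∞, ε ≠ 0 → μ (π ⁻¹' F) * μ (π ⁻¹' F)ᶜ ≤ K * ε by
    rw [← mul_eq_zero, ← nonpos_iff_eq_zero]
    have hlim : Tendsto (fun ε : ℝ≥0∞ => K * ε) (𝓝[≠] 0) (𝓝 (K * 0)) :=
      (ENNReal.Tendsto.const_mul tendsto_id (Or.inr hK)).mono_left nhdsWithin_le_nhds
    rw [mul_zero] at hlim
    exact ge_of_tendsto hlim (eventually_mem_nhdsWithin.mono h)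
  intro ε hε
  obtain ⟨U, hFU, hU, -, hUε⟩ :=
    hF.compl.exists_isOpen_sdiff_lt (μ := μ.map π) (measure_ne_top _ _) hε
  rw [sdiff_compl, Measure.map_apply hπ (hU.measurableSet.inter hF)] at hUε
  set S := ⋃ l ∈ {l ∈ G | MapsTo π (A l) U}, A l
  have hcover : (π ⁻¹' F)ᶜ ≤ᵐ[μ] S := by
    filter_upwards [hae] with x hx hxF
    obtain ⟨r, hr, hball⟩ := Metric.isOpen_iff.1 hU (π x) (hFU hxF)
    obtain ⟨l, hl, hxl, hmaps⟩ := hx r hr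
    exact mem_biUnion (show l ∈ {l | _ ∧ _} from ⟨hl, hmaps.mono_right hball⟩) hxl
  have hSU : π ⁻¹' F ∩ S ⊆ π ⁻¹' (U ∩ F) := by
    rintro x ⟨hxF, hx⟩
    obtain ⟨l, hl, hxl⟩ := mem_iUnion₂.1 hx
    exact ⟨hl.2 hxl, hxF⟩
  calc μ (π ⁻¹' F) * μ (π ⁻¹' F)ᶜ
      ≤ μ (π ⁻¹' F) * μ S := by gcongr 1; exact measure_mono_ae hcover
    _ ≤ K * μ (π ⁻¹' F ∩ S) := mul_measure_biUnion_le hA hd hm (hπ hF) fun l hl => hG l hl.1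
    _ ≤ K * ε := by gcongr; exact (measure_mono hSU).trans hUε.le

end CantorScheme

section NonnegUnimodular

/-! ### Nonnegative unimodular matrices -/

variable {ι : Type*}

/-- The open positive orthant of `ℝ^ι`. -/
def orthant (ι : Type*) : Set (ι → ℝ) := {y | ∀ i, 0 < y i}

theorem one_mem_orthant : (1 : ι → ℝ) ∈ orthant ι := fun _ => one_pos

theorem smul_mem_orthant_iff {t : ℝ} (ht : 0 < t) {y : ι → ℝ} : t • y ∈ orthant ι ↔ y ∈ orthant ι :=
  forall_congr' fun _ => mul_pos_iff_of_pos_left ht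

theorem measurableSet_orthant [Countable ι] : MeasurableSet (orthant ι) := by
  rw [orthant, ofPred_forall]
  exact .iInter fun i => measurableSet_lt measurable_const (measurable_pi_apply i)

/-- A set which is a union of open rays from the origin. -/
def IsConic (A : Set (ι → ℝ)) : Prop := ∀ t : ℝ, 0 < t → ∀ y, t • y ∈ A ↔ y ∈ A

variable [Fintype ι]

/-- The simplex cut out of the positive orthant by the half-space `q ⬝ᵥ y < 1`. All densities are
measured in `corner 1`, and a nonnegative unimodular matrix maps `corner (q ᵥ* W)` into
`corner q`. -/
def corner (q : ι → ℝ) : Set (ι → ℝ) := {y | y ∈ orthant ι ∧ q ⬝ᵥ y < 1}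

theorem measurableSet_corner (q : ι → ℝ) : MeasurableSet (corner q) :=
  measurableSet_orthant.inter (measurableSet_lt
    (Continuous.dotProduct continuous_const continuous_id).measurable measurable_const)

theorem corner_subset_orthant (q : ι → ℝ) : corner q ⊆ orthant ι := inter_subset_left

theorem dotProduct_pos {q y : ι → ℝ} (hq : q ∈ orthant ι) (hy : y ∈ orthant ι) [Nonempty ι] :
    0 < q ⬝ᵥ y :=
  Finset.sum_pos (fun i _ => mul_pos (hq i) (hy i)) Finset.univ_nonempty

theorem corner_anti {q r : ι → ℝ} (h : q ≤ r) : corner r ⊆ corner q := fun _ hy =>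
  ⟨hy.1, (dotProduct_le_dotProduct_of_nonneg_right h fun i => (hy.1 i).le).trans_lt hy.2⟩

theorem volume_corner_ne_top {q : ι → ℝ} (hq : q ∈ orthant ι) : volume (corner q) ≠ ∞ := by
  refine ne_top_of_le_ne_top (b := volume (Icc (0 : ι → ℝ) q⁻¹)) isCompact_Icc.measure_ne_top
    (measure_mono fun y hy => ⟨fun i => (hy.1 i).le, fun i => ?_⟩)
  have hi : q i * y i ≤ q ⬝ᵥ y := Finset.single_le_sum
    (fun j _ => (mul_pos (hq j) (hy.1 j)).le) (Finset.mem_univ i)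
  rw [Pi.inv_apply, ← one_div, le_div_iff₀' (hq i)]
  exact hi.trans hy.2.le

theorem volume_corner_smul_inter {t : ℝ} (ht : 0 < t) (q : ι → ℝ) {A : Set (ι → ℝ)}
    (hA : IsConic A) :
    ENNReal.ofReal (t ^ Fintype.card ι) * volume (corner (t • q) ∩ A) =
      volume (corner q ∩ A) := by
  have hsmul : t • (corner (t • q) ∩ A) = corner q ∩ A := by
    ext y
    rw [mem_smul_set_iff_inv_smul_mem₀ ht.ne', mem_inter_iff, mem_inter_iff, hA _ (inv_pos.2 ht)]
    refine and_congr_left' (and_congr (smul_mem_orthant_iff (inv_pos.2 ht)) ?_)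
    rw [smul_dotProduct, dotProduct_smul, smul_inv_smul₀ ht.ne']
  rw [← hsmul, Measure.addHaar_smul, Module.finrank_fintype_fun_eq_card,
    abs_of_pos (by positivity)]

theorem le_vecMul_of_one_le {V : Matrix ι ι ℝ} (hV : ∀ i j, 0 ≤ V i j) {l j : ι}
    (hl : 1 ≤ V l j) {s : ι → ℝ} (hs : 0 ≤ s) : s l ≤ (s ᵥ* V) j := calc
  s l ≤ s l * V l j := le_mul_of_one_le_right (hs l) hl
  _ ≤ (s ᵥ* V) j := Finset.single_le_sum (f := fun i => s i * V i j)
    (fun i _ => mul_nonneg (hs i) (hV i j)) (Finset.mem_univ l)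

theorem vecMul_le_vecMul_of_nonneg {V : Matrix ι ι ℝ} (hV : ∀ i j, 0 ≤ V i j) {s t : ι → ℝ}
    (hst : s ≤ t) : s ᵥ* V ≤ t ᵥ* V := fun j =>
  dotProduct_le_dotProduct_of_nonneg_right hst fun i => hV i j

theorem smul_vecMul_le_vecMul_of_mul_le {V : Matrix ι ι ℝ} (hV : ∀ i j, 0 ≤ V i j) {l : ι}
    (hl : ∀ j, 1 ≤ V l j) {q s : ι → ℝ} (hs : 0 ≤ s) {κ C : ℝ} (hκ : 0 ≤ κ) (hC : 0 < C)
    (hq : ∀ j, (q ᵥ* V) j ≤ C * q l) (hκs : κ * q l ≤ s l) :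
    (κ * C⁻¹) • (q ᵥ* V) ≤ s ᵥ* V := fun j => calc
  κ * C⁻¹ * (q ᵥ* V) j ≤ κ * C⁻¹ * (C * q l) := by gcongr; exact hq j
  _ = κ * q l := by field_simp
  _ ≤ (s ᵥ* V) j := hκs.trans (le_vecMul_of_one_le hV (hl j) hs)

theorem volume_corner_mul {d : ι → ℝ} (hd : d ∈ orthant ι) (q : ι → ℝ) :
    volume (corner (d * q)) = ENNReal.ofReal (∏ i, d i)⁻¹ * volume (corner q) := by
  classical
  have hdet : (∏ i, d i) ≠ 0 := (Finset.prod_pos fun i _ => hd i).ne'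
  have hpre : corner (d * q) = (toLin' (diagonal d)) ⁻¹' corner q := by
    ext y
    have h : q ⬝ᵥ (diagonal d *ᵥ y) = (d * q) ⬝ᵥ y :=
      Finset.sum_congr rfl fun i _ => by rw [mulVec_diagonal, Pi.mul_apply]; ring
    simp only [corner, orthant, mem_ofPred_eq, mem_preimage, toLin'_apply, h]
    simp only [mulVec_diagonal, mul_pos_iff_of_pos_left (hd _)]
  have hdet' : LinearMap.det (toLin' (diagonal d)) = ∏ i, d i := by
    rw [LinearMap.det_toLin', det_diagonal]
  rw [hpre, Measure.addHaar_preimage_linearMap _ (hdet' ▸ hdet), hdet',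
    abs_of_pos (inv_pos.2 (Finset.prod_pos fun i _ => hd i))]

/-- The linear forms `r ⬝ᵥ y` with `0 ≤ r ≤ 1`, normalized by `1 ⬝ᵥ y`, oscillate by at most `ε` on
the image of the positive orthant under `W`. This is expressed through the coefficients of the
forms pulled back by `W`. -/
def IsPinching (ε : ℝ) (W : Matrix ι ι ℝ) : Prop :=
  ∀ r : ι → ℝ, 0 ≤ r → r ≤ 1 → ∃ a b : ℝ, b - a ≤ ε ∧
    a • (1 ᵥ* W) ≤ r ᵥ* W ∧ r ᵥ* W ≤ b • (1 ᵥ* W)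

theorem isPinching_one {W : Matrix ι ι ℝ} (hW : ∀ i j, 0 ≤ W i j) : IsPinching 1 W :=
  fun r h0 h1 => ⟨0, 1, by norm_num,
    by simpa using vecMul_le_vecMul_of_nonneg hW h0,
    by simpa using vecMul_le_vecMul_of_nonneg hW h1⟩

variable [DecidableEq ι]

theorem transvection_mulVec (i j : ι) (c : ℝ) (y : ι → ℝ) :
    Matrix.transvection i j c *ᵥ y = Function.update y i (y i + c * y j) := by
  rw [Matrix.transvection, add_mulVec, one_mulVec, single_mulVec]
  funext k
  rcases eq_or_ne k i with rfl | hk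
  · simp
  · simp [hk]

theorem vecMul_transvection (i j : ι) (c : ℝ) (q : ι → ℝ) :
    q ᵥ* Matrix.transvection i j c = Function.update q j (q j + c * q i) := by
  rw [← mulVec_transpose, Matrix.transvection, transpose_add, transpose_one, transpose_single]
  exact transvection_mulVec j i c q

/-- A matrix with nonnegative entries and determinant `± 1`: such a matrix maps the positive
orthant into itself and preserves volume. -/
structure IsNonnegUnimodular (W : Matrix ι ι ℝ) : Prop where
  nonneg : ∀ i j, 0 ≤ W i j
  abs_det : |W.det| = 1

namespace IsNonnegUnimodular

theorem one : IsNonnegUnimodular (1 : Matrix ι ι ℝ) :=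
  ⟨fun i j => by rw [one_apply]; positivity, by simp⟩

theorem permMatrix (σ : Equiv.Perm ι) : IsNonnegUnimodular (σ.permMatrix ℝ) :=
  ⟨fun i j => by
    change 0 ≤ PEquiv.toMatrix _ i j
    rw [PEquiv.toMatrix_apply]
    positivity, by
    rw [det_permutation]
    rcases Int.units_eq_one_or (Equiv.Perm.sign σ) with h | h <;> simp [h]⟩

theorem transvection {i j : ι} (hij : i ≠ j) {c : ℝ} (hc : 0 ≤ c) :
    IsNonnegUnimodular (Matrix.transvection i j c) :=
  ⟨fun k l => by
    rw [Matrix.transvection, Matrix.add_apply, one_apply, single_apply]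
    positivity, by
    rw [det_transvection_of_ne i j hij, abs_one]⟩

variable {V W : Matrix ι ι ℝ}

theorem mul (hV : IsNonnegUnimodular V) (hW : IsNonnegUnimodular W) :
    IsNonnegUnimodular (V * W) :=
  ⟨fun i j => Finset.sum_nonneg fun k _ => mul_nonneg (hV.nonneg i k) (hW.nonneg k j), by
    rw [det_mul, abs_mul, hV.abs_det, hW.abs_det, one_mul]⟩

theorem transpose (hW : IsNonnegUnimodular W) : IsNonnegUnimodular Wᵀ :=
  ⟨fun i j => hW.nonneg j i, by rw [det_transpose, hW.abs_det]⟩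

theorem isUnit (hW : IsNonnegUnimodular W) : IsUnit W := by
  rw [isUnit_iff_isUnit_det, isUnit_iff_ne_zero]
  intro h
  simpa [h] using hW.abs_det

theorem mulVec_mem_orthant (hW : IsNonnegUnimodular W) {y : ι → ℝ} (hy : y ∈ orthant ι) :
    W *ᵥ y ∈ orthant ι := fun i => by
  have hrow : ∃ j, W i j ≠ 0 := by
    by_contra! h
    simpa [det_eq_zero_of_row_eq_zero i h] using hW.abs_det
  obtain ⟨j, hj⟩ := hrow
  exact Finset.sum_pos' (fun k _ => mul_nonneg (hW.nonneg i k) (hy k).le)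
    ⟨j, Finset.mem_univ j, mul_pos ((hW.nonneg i j).lt_of_ne' hj) (hy j)⟩

theorem vecMul_mem_orthant (hW : IsNonnegUnimodular W) {q : ι → ℝ} (hq : q ∈ orthant ι) :
    q ᵥ* W ∈ orthant ι := by
  rw [← mulVec_transpose]
  exact hW.transpose.mulVec_mem_orthant hq

theorem measurableSet_image (hW : IsNonnegUnimodular W) {s : Set (ι → ℝ)} (hs : MeasurableSet s) :
    MeasurableSet (W.mulVec '' s) :=
  ((Continuous.matrix_mulVec continuous_const continuous_id).measurableEmbedding
    (mulVec_injective_of_isUnit hW.isUnit)).measurableSet_image.2 hs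

theorem volume_image (hW : IsNonnegUnimodular W) (s : Set (ι → ℝ)) :
    volume (W.mulVec '' s) = volume s := by
  have h := Measure.addHaar_image_linearMap volume (toLin' W) s
  rwa [LinearMap.det_toLin', hW.abs_det, ENNReal.ofReal_one, one_mul] at h

theorem corner_inter_image (hW : IsNonnegUnimodular W) (q : ι → ℝ) {s : Set (ι → ℝ)}
    (hs : s ⊆ orthant ι) :
    corner q ∩ W.mulVec '' s = W.mulVec '' (corner (q ᵥ* W) ∩ s) := by
  ext y
  constructor
  · rintro ⟨hy, y, hys, rfl⟩
    exact ⟨y, ⟨⟨hs hys, by rw [← dotProduct_mulVec]; exact hy.2⟩, hys⟩, rfl⟩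
  · rintro ⟨y, ⟨hy, hys⟩, rfl⟩
    exact ⟨⟨hW.mulVec_mem_orthant hy.1, by rw [dotProduct_mulVec]; exact hy.2⟩, y, hys, rfl⟩

theorem volume_corner_inter_image (hW : IsNonnegUnimodular W) (q : ι → ℝ) {s : Set (ι → ℝ)}
    (hs : s ⊆ orthant ι) :
    volume (corner q ∩ W.mulVec '' s) = volume (corner (q ᵥ* W) ∩ s) := by
  rw [hW.corner_inter_image q hs, hW.volume_image]

theorem volume_corner_inter_image_orthant (hW : IsNonnegUnimodular W) (q : ι → ℝ) :
    volume (corner q ∩ W.mulVec '' orthant ι) = volume (corner (q ᵥ* W)) := by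
  rw [hW.volume_corner_inter_image q Subset.rfl, inter_eq_left.2 (corner_subset_orthant _)]

theorem volume_corner_inter_le_of_balanced (hW : IsNonnegUnimodular W) {A : Set (ι → ℝ)}
    (hA : IsConic A) (hWA : ∀ y ∈ orthant ι, W *ᵥ y ∈ A ↔ y ∈ A)
    {t C : ℝ} (ht : 0 < t) (hC : 0 < C) (hlow : t • 1 ≤ 1 ᵥ* W) (hup : 1 ᵥ* W ≤ (C * t) • 1) :
    volume (corner 1 ∩ A) * volume (corner 1 ∩ W.mulVec '' orthant ι) ≤
      ENNReal.ofReal (C ^ Fintype.card ι) * volume (corner (1 : ι → ℝ)) *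
        volume (corner 1 ∩ A ∩ W.mulVec '' orthant ι) := by
  set N := Fintype.card ι
  have hinter : corner 1 ∩ A ∩ W.mulVec '' orthant ι = corner 1 ∩ W.mulVec '' (A ∩ orthant ι) := by
    ext y
    constructor
    · rintro ⟨⟨hy, hyA⟩, y, hyo, rfl⟩
      exact ⟨hy, y, ⟨(hWA y hyo).1 hyA, hyo⟩, rfl⟩
    · rintro ⟨hy, y, ⟨hyA, hyo⟩, rfl⟩
      exact ⟨⟨hy, (hWA y hyo).2 hyA⟩, y, hyo, rfl⟩
  have hwhole : ENNReal.ofReal (t ^ N) * volume (corner 1 ∩ W.mulVec '' orthant ι) ≤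
      volume (corner (1 : ι → ℝ)) := by
    rw [hW.volume_corner_inter_image_orthant]
    refine (mul_le_mul_right (measure_mono (corner_anti hlow)) _).trans_eq ?_
    simpa using volume_corner_smul_inter ht (1 : ι → ℝ) (A := univ) (fun _ _ _ => Iff.rfl)
  have hpart : volume (corner 1 ∩ A) ≤ ENNReal.ofReal ((C * t) ^ N) *
      volume (corner 1 ∩ A ∩ W.mulVec '' orthant ι) := by
    rw [hinter, hW.volume_corner_inter_image 1 inter_subset_right, inter_comm A, ← inter_assoc,
      inter_eq_left.2 (corner_subset_orthant _), ← volume_corner_smul_inter (mul_pos hC ht) 1 hA]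
    gcongr
    exact corner_anti hup
  calc volume (corner 1 ∩ A) * volume (corner 1 ∩ W.mulVec '' orthant ι)
      ≤ ENNReal.ofReal ((C * t) ^ N) * volume (corner 1 ∩ A ∩ W.mulVec '' orthant ι) *
          volume (corner 1 ∩ W.mulVec '' orthant ι) := by gcongr
    _ = ENNReal.ofReal (C ^ N) * volume (corner 1 ∩ A ∩ W.mulVec '' orthant ι) *
          (ENNReal.ofReal (t ^ N) * volume (corner 1 ∩ W.mulVec '' orthant ι)) := by
        rw [mul_pow, ENNReal.ofReal_mul (by positivity)]
        ring
    _ ≤ ENNReal.ofReal (C ^ N) * volume (corner 1 ∩ A ∩ W.mulVec '' orthant ι) *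
          volume (corner (1 : ι → ℝ)) := by gcongr
    _ = _ := by ring

end IsNonnegUnimodular

theorem IsPinching.abs_div_sub_div_le {ε : ℝ} {W : Matrix ι ι ℝ} (h : IsPinching ε W)
    (hW : IsNonnegUnimodular W) [Nonempty ι] {r : ι → ℝ} (h0 : 0 ≤ r) (h1 : r ≤ 1)
    {y z : ι → ℝ} (hy : y ∈ W.mulVec '' orthant ι) (hz : z ∈ W.mulVec '' orthant ι) :
    |r ⬝ᵥ y / 1 ⬝ᵥ y - r ⬝ᵥ z / 1 ⬝ᵥ z| ≤ ε := by
  obtain ⟨a, b, hab, ha, hb⟩ := h r h0 h1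
  have hmem : ∀ y ∈ W.mulVec '' orthant ι, r ⬝ᵥ y / 1 ⬝ᵥ y ∈ Icc a b := by
    rintro _ ⟨y, hy, rfl⟩
    have hy0 : 0 ≤ y := fun i => (hy i).le
    have hpos : 0 < 1 ⬝ᵥ W *ᵥ y := dotProduct_pos one_mem_orthant (hW.mulVec_mem_orthant hy)
    rw [mem_Icc, le_div_iff₀ hpos, div_le_iff₀ hpos, dotProduct_mulVec, dotProduct_mulVec,
      ← smul_eq_mul, ← smul_eq_mul, ← smul_dotProduct, ← smul_dotProduct]
    exact ⟨dotProduct_le_dotProduct_of_nonneg_right ha hy0,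
      dotProduct_le_dotProduct_of_nonneg_right hb hy0⟩
  exact (abs_sub_le_of_le_of_le (hmem y hy).1 (hmem y hy).2 (hmem z hz).1 (hmem z hz).2).trans hab

/-- A form that is pinched between `a • (1 ᵥ* W)` and `b • (1 ᵥ* W)` is, at the index `l`, at least
half of `b - a` away from one of the two bounds; the row `l` of `V` spreads this gain to all
indices. -/
theorem IsPinching.mul {ε C : ℝ} {V W : Matrix ι ι ℝ} (h : IsPinching ε W)
    (hW : IsNonnegUnimodular W) (hV : ∀ i j, 0 ≤ V i j) {l : ι} (hl : ∀ j, 1 ≤ V l j)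
    (hC : ∀ j, (1 ᵥ* (W * V)) j ≤ C * (1 ᵥ* W) l) :
    IsPinching ((1 - C⁻¹ / 2) * ε) (W * V) := by
  intro r h0 h1
  obtain ⟨a, b, hab, ha, hb⟩ := h r h0 h1
  simp only [← vecMul_vecMul] at hC ⊢
  set q := 1 ᵥ* W
  set p := r ᵥ* W
  have hq : q ∈ orthant ι := hW.vecMul_mem_orthant one_mem_orthant
  have hC1 : 1 ≤ C := le_of_mul_le_mul_right
    ((one_mul (q l)).trans_le ((le_vecMul_of_one_le hV (hl l) fun i => (hq i).le).trans (hC l)))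
    (hq l)
  have hab0 : 0 ≤ b - a := sub_nonneg.2 (le_of_mul_le_mul_right ((ha l).trans (hb l)) (hq l))
  have spread {s : ι → ℝ} (hs : 0 ≤ s) (hsl : (b - a) / 2 * q l ≤ s l) :
      ((b - a) / 2 * C⁻¹) • (q ᵥ* V) ≤ s ᵥ* V :=
    smul_vecMul_le_vecMul_of_mul_le hV hl hs (by positivity) (by positivity) hC hsl
  have hwidth : b - a - (b - a) / 2 * C⁻¹ ≤ (1 - C⁻¹ / 2) * ε := by
    have hrate : 0 ≤ 1 - C⁻¹ / 2 := by linarith [inv_le_one_of_one_le₀ hC1]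
    linarith [mul_le_mul_of_nonneg_left hab hrate]
  rcases le_total ((a + b) / 2 * q l) (p l) with hp | hp
  · refine ⟨a + (b - a) / 2 * C⁻¹, b, by linarith, ?_,
      by simpa [smul_vecMul] using vecMul_le_vecMul_of_nonneg hV hb⟩
    have hs := spread (s := p - a • q) (sub_nonneg.2 ha) (by
      simp only [Pi.sub_apply, Pi.smul_apply, smul_eq_mul]
      linarith)
    rw [sub_vecMul, smul_vecMul, le_sub_iff_add_le'] at hs
    rwa [add_smul]
  · refine ⟨a, b - (b - a) / 2 * C⁻¹, by linarith,
      by simpa [smul_vecMul] using vecMul_le_vecMul_of_nonneg hV ha, ?_⟩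
    have hs := spread (s := b • q - p) (sub_nonneg.2 hb) (by
      simp only [Pi.sub_apply, Pi.smul_apply, smul_eq_mul]
      linarith)
    rw [sub_vecMul, smul_vecMul] at hs
    rw [sub_smul]
    exact le_sub_comm.1 hs

end NonnegUnimodular

theorem volume_corner_inter_mul_lt_le {ι : Type*} [Fintype ι] {q : ι → ℝ} {i j : ι} (hij : i ≠ j)
    {β : ℝ} (hβ : 0 ≤ β) (hqβ : q j ≤ β * q i) :
    volume (corner q ∩ {y | β * y j < y i}) ≤ 2⁻¹ * volume (corner q) := by
  classical
  set d : ι → ℝ := Function.update 1 j 2 with hd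
  have hdo : d ∈ orthant ι := fun k => by
    rcases eq_or_ne k j with rfl | hk
    · simp [d]
    · simp [d, hk]
  have hT : IsNonnegUnimodular (Matrix.transvection i j β) := .transvection hij hβ
  have himage : corner q ∩ {y | β * y j < y i} ⊆
      corner q ∩ (Matrix.transvection i j β).mulVec '' orthant ι := by
    rintro y ⟨hy, hlt⟩
    refine ⟨hy, Matrix.transvection i j (-β) *ᵥ y, fun k => ?_, ?_⟩
    · rw [transvection_mulVec]
      rcases eq_or_ne k i with rfl | hk
      · simpa using hlt
      · simpa [hk] using hy.1 k
    · rw [mulVec_mulVec, transvection_mul_transvection_same i j hij, add_neg_cancel,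
        transvection_zero, one_mulVec]
  have hcol : d * q ≤ q ᵥ* Matrix.transvection i j β := fun k => by
    rw [vecMul_transvection]
    rcases eq_or_ne k j with rfl | hk
    · simpa [d, two_mul] using hqβ
    · simp [d, hk]
  have hprod : ∏ k, d k = 2 := by simp [hd, Finset.prod_update_of_mem]
  calc volume (corner q ∩ {y | β * y j < y i})
      ≤ volume (corner (q ᵥ* Matrix.transvection i j β)) :=
        (measure_mono himage).trans_eq (hT.volume_corner_inter_image_orthant q)
    _ ≤ volume (corner (d * q)) := measure_mono (corner_anti hcol)
    _ = 2⁻¹ * volume (corner q) := by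
        rw [volume_corner_mul hdo, hprod, ENNReal.ofReal_inv_of_pos two_pos, ENNReal.ofReal_ofNat]

section Branches

/-! ### The inverse branches in homogeneous coordinates -/

variable {m : ℕ}

/-- The inverse branch of the triangle map with digit `b`, in the homogeneous coordinates
`yᵢ = xᵢ - xᵢ₊₁` of the points `1 ≥ x₁ ≥ ⋯ ≥ xₙ ≥ 0`. -/
noncomputable def branchMatrix (m b : ℕ) : Matrix (Fin (m + 2)) (Fin (m + 2)) ℝ :=
  Matrix.transvection 0 (Fin.last _) (b : ℝ) *
    (Matrix.transvection (Fin.last _) 0 1 * Equiv.Perm.permMatrix ℝ (finRotate (m + 2)).symm)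

theorem isNonnegUnimodular_branchMatrix (m b : ℕ) : IsNonnegUnimodular (branchMatrix m b) :=
  .mul (.transvection (Fin.last_pos).ne b.cast_nonneg)
    (.mul (.transvection (Fin.last_pos).ne' zero_le_one) (.permMatrix (finRotate (m + 2)).symm))

theorem finRotate_castSucc (n : ℕ) (i : Fin n) : finRotate (n + 1) i.castSucc = i.succ := by
  rw [finRotate_apply, Fin.coeSucc_eq_succ]

theorem finRotate_symm_succ (n : ℕ) (i : Fin n) : (finRotate (n + 1)).symm i.succ = i.castSucc := by
  rw [Equiv.symm_apply_eq, finRotate_castSucc]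

theorem finRotate_symm_zero (n : ℕ) : (finRotate (n + 1)).symm 0 = Fin.last n := by
  rw [Equiv.symm_apply_eq, finRotate_last]

theorem branchMatrix_mulVec (b : ℕ) (y : Fin (m + 2) → ℝ) :
    branchMatrix m b *ᵥ y = Function.update (Function.update (y ∘ ⇑(finRotate (m + 2)).symm)
      (Fin.last _) (y (Fin.last m).castSucc + y (Fin.last _))) 0
      (y (Fin.last _) + b * (y (Fin.last m).castSucc + y (Fin.last _))) := by
  have hlast : (finRotate (m + 2)).symm (Fin.last (m + 1)) = (Fin.last m).castSucc := by
    rw [← Fin.succ_last, finRotate_symm_succ]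
  rw [branchMatrix, ← mulVec_mulVec, ← mulVec_mulVec, permMatrix_mulVec, transvection_mulVec,
    transvection_mulVec, Function.update_self,
    Function.update_of_ne Fin.last_pos.ne, Function.comp_apply, Function.comp_apply,
    finRotate_symm_zero, hlast, one_mul]

theorem vecMul_branchMatrix (b : ℕ) (q : Fin (m + 2) → ℝ) :
    q ᵥ* branchMatrix m b = Function.update (Function.update q
      (Fin.last _) (q (Fin.last _) + b * q 0)) 0
      (q 0 + (q (Fin.last _) + b * q 0)) ∘ ⇑(finRotate (m + 2)) := by
  rw [branchMatrix, ← vecMul_vecMul, ← vecMul_vecMul, vecMul_permMatrix,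
    vecMul_transvection, vecMul_transvection, Function.update_self,
    Function.update_of_ne Fin.last_pos.ne, Equiv.symm_symm, one_mul]

theorem branchMatrix_mulVec_zero (b : ℕ) (y : Fin (m + 2) → ℝ) :
    (branchMatrix m b *ᵥ y) 0 =
      y (Fin.last _) + b * (y (Fin.last m).castSucc + y (Fin.last _)) := by
  simp [branchMatrix_mulVec]

theorem branchMatrix_mulVec_last (b : ℕ) (y : Fin (m + 2) → ℝ) :
    (branchMatrix m b *ᵥ y) (Fin.last _) = y (Fin.last m).castSucc + y (Fin.last _) := by
  simp [branchMatrix_mulVec]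

theorem branchMatrix_mulVec_castSucc_succ (b : ℕ) (y : Fin (m + 2) → ℝ) (i : Fin m) :
    (branchMatrix m b *ᵥ y) i.castSucc.succ = y i.castSucc.castSucc := by
  rw [branchMatrix_mulVec, Function.update_of_ne (Fin.succ_ne_zero _),
    Function.update_of_ne (by simp [← Fin.succ_last, Fin.castSucc_ne_last]), Function.comp_apply,
    finRotate_symm_succ]

theorem vecMul_branchMatrix_last (b : ℕ) (q : Fin (m + 2) → ℝ) :
    (q ᵥ* branchMatrix m b) (Fin.last _) = q 0 + (q (Fin.last _) + b * q 0) := by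
  simp [vecMul_branchMatrix]

theorem vecMul_branchMatrix_castSucc_last (b : ℕ) (q : Fin (m + 2) → ℝ) :
    (q ᵥ* branchMatrix m b) (Fin.last m).castSucc = q (Fin.last _) + b * q 0 := by
  simp [vecMul_branchMatrix]

theorem vecMul_branchMatrix_castSucc_castSucc (b : ℕ) (q : Fin (m + 2) → ℝ) (i : Fin m) :
    (q ᵥ* branchMatrix m b) i.castSucc.castSucc = q i.castSucc.succ := by
  simp [vecMul_branchMatrix]

theorem mem_branchMatrix_image_orthant_iff {b : ℕ} {y : Fin (m + 2) → ℝ} :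
    y ∈ (branchMatrix m b).mulVec '' orthant _ ↔
      y ∈ orthant _ ∧ b * y (Fin.last _) < y 0 ∧ y 0 < (b + 1) * y (Fin.last _) := by
  have hM := isNonnegUnimodular_branchMatrix m b
  constructor
  · rintro ⟨z, hz, rfl⟩
    refine ⟨hM.mulVec_mem_orthant hz, ?_⟩
    rw [branchMatrix_mulVec_zero, branchMatrix_mulVec_last]
    constructor <;> linarith [hz (Fin.last _), hz (Fin.last m).castSucc]
  · rintro ⟨hy, hlow, hup⟩
    obtain ⟨z, rfl⟩ := mulVec_surjective_iff_isUnit.2 hM.isUnit y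
    rw [branchMatrix_mulVec_zero, branchMatrix_mulVec_last] at hlow hup
    refine ⟨z, fun i => ?_, rfl⟩
    induction i using Fin.lastCases with
    | last => linarith
    | cast i =>
      induction i using Fin.lastCases with
      | last => linarith
      | cast i => simpa [branchMatrix_mulVec_castSucc_succ] using hy i.castSucc.succ

theorem ae_exists_mem_branchMatrix_image (m : ℕ) :
    ∀ᵐ y : Fin (m + 2) → ℝ, y ∈ orthant _ → ∃ b, y ∈ (branchMatrix m b).mulVec '' orthant _ := by
  have hne (b : ℕ) : ∀ᵐ y : Fin (m + 2) → ℝ, b * y (Fin.last _) ≠ y 0 := by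
    have hT : IsNonnegUnimodular (Matrix.transvection 0 (Fin.last (m + 1)) (b : ℝ)) :=
      .transvection Fin.last_pos.ne b.cast_nonneg
    have himage : {y : Fin (m + 2) → ℝ | ¬ b * y (Fin.last _) ≠ y 0} ⊆
        (Matrix.transvection 0 (Fin.last _) (b : ℝ)).mulVec '' {y | ¬ y 0 ≠ 0} := by
      intro y hy
      refine ⟨Function.update y 0 0, by simp, ?_⟩
      rw [transvection_mulVec, Function.update_self, Function.update_of_ne Fin.last_pos.ne',
        zero_add, not_not.1 hy, Function.update_idem, Function.update_eq_self]
    refine measure_mono_null himage ?_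
    rw [hT.volume_image]
    exact Measure.ae_eval_ne _ 0 0
  filter_upwards [ae_all_iff.2 hne] with y hy hyo
  have hl := hyo (Fin.last _)
  refine ⟨⌊y 0 / y (Fin.last _)⌋₊, mem_branchMatrix_image_orthant_iff.2 ⟨hyo, ?_, ?_⟩⟩
  · exact lt_of_le_of_ne ((le_div_iff₀ hl).1 (Nat.floor_le (div_pos (hyo 0) hl).le)) (hy _)
  · exact (div_lt_iff₀ hl).1 (Nat.lt_floor_add_one _)

/-- The product of the inverse branches along a word. The head of the word is the latest digit, so
that refining a word is `List.cons`. -/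
noncomputable def wordMatrix (m : ℕ) : List ℕ → Matrix (Fin (m + 2)) (Fin (m + 2)) ℝ
  | [] => 1
  | b :: w => wordMatrix m w * branchMatrix m b

theorem wordMatrix_append (v w : List ℕ) :
    wordMatrix m (v ++ w) = wordMatrix m w * wordMatrix m v := by
  induction v with
  | nil => exact (mul_one _).symm
  | cons b v ih => rw [List.cons_append, wordMatrix, ih, wordMatrix, Matrix.mul_assoc]

theorem isNonnegUnimodular_wordMatrix (m : ℕ) (w : List ℕ) :
    IsNonnegUnimodular (wordMatrix m w) := by
  induction w with
  | nil => exact .one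
  | cons b w ih => exact ih.mul (isNonnegUnimodular_branchMatrix m b)

/-- The cone of homogeneous coordinates of the points whose first digits are given by a word. -/
def cylinder (m : ℕ) (w : List ℕ) : Set (Fin (m + 2) → ℝ) := (wordMatrix m w).mulVec '' orthant _

theorem cylinder_nil (m : ℕ) : cylinder m [] = orthant _ := by
  simp [cylinder, wordMatrix]

theorem cylinder_cons (m b : ℕ) (w : List ℕ) : cylinder m (b :: w) =
    (wordMatrix m w).mulVec '' ((branchMatrix m b).mulVec '' orthant _) := by
  simp only [cylinder, wordMatrix, image_image, mulVec_mulVec]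

theorem measurableSet_cylinder (m : ℕ) (w : List ℕ) : MeasurableSet (cylinder m w) :=
  (isNonnegUnimodular_wordMatrix m w).measurableSet_image measurableSet_orthant

theorem antitone_cylinder (m : ℕ) : CantorScheme.Antitone (cylinder m) := fun w b => by
  rw [cylinder_cons]
  exact image_mono fun y hy => (mem_branchMatrix_image_orthant_iff.1 hy).1

theorem disjoint_cylinder (m : ℕ) : CantorScheme.Disjoint (cylinder m) := fun w b c hbc => by
  change Disjoint (cylinder m (b :: w)) (cylinder m (c :: w))
  rw [cylinder_cons, cylinder_cons,
    disjoint_image_iff (mulVec_injective_of_isUnit (isNonnegUnimodular_wordMatrix m w).isUnit)]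
  refine disjoint_left.2 fun y hy hy' => hbc ?_
  obtain ⟨hyo, hb, hb'⟩ := mem_branchMatrix_image_orthant_iff.1 hy
  obtain ⟨-, hc, hc'⟩ := mem_branchMatrix_image_orthant_iff.1 hy'
  have hlt {k l : ℕ} (hk : k * y (Fin.last _) < y 0) (hl : y 0 < (l + 1) * y (Fin.last _)) :
      k < l + 1 := by
    exact_mod_cast lt_of_mul_lt_mul_right (hk.trans hl) (hyo _).le
  have h1 := hlt hb hc'
  have h2 := hlt hc hb'
  omega

theorem ae_exists_mem_cylinder_cons (m : ℕ) (w : List ℕ) :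
    ∀ᵐ y, y ∈ cylinder m w → ∃ b, y ∈ cylinder m (b :: w) := by
  have hnull : volume ((wordMatrix m w).mulVec ''
      {y | ¬ (y ∈ orthant _ → ∃ b, y ∈ (branchMatrix m b).mulVec '' orthant _)}) = 0 := by
    rw [(isNonnegUnimodular_wordMatrix m w).volume_image]
    exact ae_iff.1 (ae_exists_mem_branchMatrix_image m)
  filter_upwards [measure_eq_zero_iff_ae_notMem.1 hnull] with z hz hzw
  obtain ⟨y, hyo, rfl⟩ := hzw
  simp only [cylinder_cons]
  by_contra! h
  exact hz ⟨y, fun h' => (h' hyo).elim fun b hb => h b ⟨y, hb, rfl⟩, rfl⟩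

/-- The column sums of `wordMatrix m w`, that is, the coefficients of the form `∑ i, y i` pulled
back to the parameters of the cylinder of `w`. -/
noncomputable def weight (m : ℕ) (w : List ℕ) : Fin (m + 2) → ℝ := 1 ᵥ* wordMatrix m w

theorem weight_cons (b : ℕ) (w : List ℕ) : weight m (b :: w) = weight m w ᵥ* branchMatrix m b :=
  (vecMul_vecMul _ _ _).symm

theorem weight_append (v w : List ℕ) : weight m (v ++ w) = weight m w ᵥ* wordMatrix m v := by
  rw [weight, wordMatrix_append, ← vecMul_vecMul, weight]

theorem weight_pos (m : ℕ) (w : List ℕ) (i : Fin (m + 2)) : 0 < weight m w i :=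
  (isNonnegUnimodular_wordMatrix m w).vecMul_mem_orthant one_mem_orthant i

theorem weight_le_weight_last (m : ℕ) (w : List ℕ) (i : Fin (m + 2)) :
    weight m w i ≤ weight m w (Fin.last _) := by
  induction w generalizing i with
  | nil => simp [weight, wordMatrix]
  | cons b w ih =>
    have h0 := weight_pos m w 0
    have hb : 0 ≤ b * weight m w 0 := by positivity
    rw [weight_cons, vecMul_branchMatrix_last]
    induction i using Fin.lastCases with
    | last => rw [vecMul_branchMatrix_last]
    | cast i =>
      induction i using Fin.lastCases with
      | last => rw [vecMul_branchMatrix_castSucc_last]; linarith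
      | cast i => rw [vecMul_branchMatrix_castSucc_castSucc]; linarith [ih i.castSucc.succ]

theorem one_le_wordMatrix_last (v : List ℕ) (i : Fin (m + 2)) (hi : m + 1 ≤ i + v.length) :
    1 ≤ wordMatrix m v (Fin.last _) i := by
  induction v generalizing i with
  | nil =>
    have : i = Fin.last _ := Fin.last_le_iff.1 (Fin.le_def.2 (by simpa using hi))
    rw [this, wordMatrix, one_apply_eq]
  | cons b v ih =>
    have h0 := (isNonnegUnimodular_wordMatrix m v).nonneg (Fin.last _) 0
    have hb : 0 ≤ b * wordMatrix m v (Fin.last _) 0 := by positivity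
    have hlast := ih (Fin.last _) (by simp)
    rw [wordMatrix, mul_apply_eq_vecMul]
    induction i using Fin.lastCases with
    | last => rw [vecMul_branchMatrix_last]; linarith
    | cast i =>
      induction i using Fin.lastCases with
      | last => rw [vecMul_branchMatrix_castSucc_last]; linarith
      | cast i =>
        rw [vecMul_branchMatrix_castSucc_castSucc]
        exact ih _ (by simpa [add_assoc, add_comm 1] using hi)

/-! ### Tame digits -/

/-- `IsTameExtension m w k u` says that the word `u` extends `w` by `k` further digits, each of
which is at most the ratio of the last and first weights of the word that precedes it. Such digits
have conditional probability at least one half, and keep the weights under control. -/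
inductive IsTameExtension (m : ℕ) (w : List ℕ) : ℕ → List ℕ → Prop
  | refl : IsTameExtension m w 0 w
  | cons {k : ℕ} {v : List ℕ} {b : ℕ} (hv : IsTameExtension m w k v)
      (hb : b * weight m v 0 ≤ weight m v (Fin.last _)) : IsTameExtension m w (k + 1) (b :: v)

/-- A word is balanced when its weights agree up to the factor `3 ^ (m + 1)`. On the cylinder of
such a word the distortion is bounded. -/
def IsBalanced (m : ℕ) (w : List ℕ) : Prop :=
  ∃ t : ℝ, 0 < t ∧ t • 1 ≤ weight m w ∧ weight m w ≤ ((3 : ℝ) ^ (m + 1) * t) • 1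

/-- The factor by which `m + 1` tame digits contract projective oscillations. -/
noncomputable def pinchRate (m : ℕ) : ℝ := 1 - ((3 : ℝ) ^ (m + 1))⁻¹ / 2

theorem pinchRate_nonneg (m : ℕ) : 0 ≤ pinchRate m := by
  have h : ((3 : ℝ) ^ (m + 1))⁻¹ ≤ 1 := inv_le_one_of_one_le₀ (one_le_pow₀ (by norm_num))
  rw [pinchRate]
  linarith

theorem pinchRate_lt_one (m : ℕ) : pinchRate m < 1 := by
  rw [pinchRate, sub_lt_self_iff]
  positivity

namespace IsTameExtension

variable {k l : ℕ} {u w : List ℕ}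

theorem exists_of_add (h : IsTameExtension m w (k + l) u) :
    ∃ v, IsTameExtension m w k v ∧ IsTameExtension m v l u := by
  induction l generalizing u with
  | zero => exact ⟨u, h, refl⟩
  | succ l ih =>
    obtain _ | ⟨hv, hb⟩ := h
    obtain ⟨v, hwv, hvu⟩ := ih hv
    exact ⟨v, hwv, hvu.cons hb⟩

theorem exists_append (h : IsTameExtension m w k u) : ∃ v : List ℕ, v.length = k ∧ v ++ w = u := by
  induction h with
  | refl => exact ⟨[], rfl, rfl⟩
  | @cons _ _ b _ _ ih =>
    obtain ⟨v, rfl, rfl⟩ := ih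
    exact ⟨b :: v, rfl, rfl⟩

theorem weight_le (h : IsTameExtension m w k u) (i : Fin (m + 2)) :
    weight m u i ≤ 3 ^ k * weight m w (Fin.last _) := by
  refine (weight_le_weight_last m u i).trans ?_
  induction h with
  | refl => simp
  | @cons k v b _ hb ih => calc
      weight m (b :: v) (Fin.last _) ≤ 3 * weight m v (Fin.last _) := by
        rw [weight_cons, vecMul_branchMatrix_last]
        linarith [weight_le_weight_last m v 0]
      _ ≤ 3 * (3 ^ k * weight m w (Fin.last _)) := by gcongr
      _ = 3 ^ (k + 1) * weight m w (Fin.last _) := by ring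

theorem weight_last_le (h : IsTameExtension m w (m + 1) u) (i : Fin (m + 2)) :
    weight m w (Fin.last _) ≤ weight m u i := by
  obtain ⟨v, hv, rfl⟩ := h.exists_append
  rw [weight_append]
  exact le_vecMul_of_one_le (isNonnegUnimodular_wordMatrix m v).nonneg
    (one_le_wordMatrix_last v i (by omega)) fun i => (weight_pos m w i).le

theorem isBalanced (h : IsTameExtension m w (m + 1) u) : IsBalanced m u :=
  ⟨weight m w (Fin.last _), weight_pos m w _, fun i => by simpa using h.weight_last_le i,
    fun i => by simpa using h.weight_le i⟩

theorem isPinching (h : IsTameExtension m w (m + 1) u) {ε : ℝ}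
    (hε : IsPinching ε (wordMatrix m w)) : IsPinching (pinchRate m * ε) (wordMatrix m u) := by
  have hweight := h.weight_le
  obtain ⟨v, hv, rfl⟩ := h.exists_append
  simp only [weight, wordMatrix_append] at hweight ⊢
  exact hε.mul (isNonnegUnimodular_wordMatrix m w) (isNonnegUnimodular_wordMatrix m v).nonneg
    (fun i => one_le_wordMatrix_last v i (by omega)) hweight

theorem isPinching_pow {j : ℕ} (h : IsTameExtension m w (j * (m + 1)) u) :
    IsPinching (pinchRate m ^ j) (wordMatrix m u) := by
  induction j generalizing u with
  | zero => simpa using isPinching_one (isNonnegUnimodular_wordMatrix m u).nonneg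
  | succ j ih =>
    rw [add_one_mul] at h
    obtain ⟨v, hwv, hvu⟩ := h.exists_of_add
    rw [pow_succ']
    exact hvu.isPinching (ih hwv)

end IsTameExtension

theorem half_volume_corner_le {q : Fin (m + 2) → ℝ} (hq : q ∈ orthant _) :
    2⁻¹ * volume (corner q) ≤ volume (corner q ∩
      ⋃ b ∈ {b : ℕ | b * q 0 ≤ q (Fin.last _)}, (branchMatrix m b).mulVec '' orthant _) := by
  set tame := ⋃ b ∈ {b : ℕ | b * q 0 ≤ q (Fin.last _)}, (branchMatrix m b).mulVec '' orthant _
  set k := ⌊q (Fin.last _) / q 0⌋₊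
  set wild := {y : Fin (m + 2) → ℝ | ((k + 1 : ℕ) : ℝ) * y (Fin.last _) < y 0}
  have hwild : volume (corner q ∩ wild) ≤ 2⁻¹ * volume (corner q) := by
    refine volume_corner_inter_mul_lt_le Fin.last_pos.ne (Nat.cast_nonneg _) ?_
    rw [Nat.cast_add_one]
    exact ((div_lt_iff₀ (hq 0)).1 (Nat.lt_floor_add_one _)).le
  have hcover : corner q ≤ᵐ[volume] (corner q ∩ wild ∪ corner q ∩ tame : Set _) := by
    filter_upwards [ae_exists_mem_branchMatrix_image m] with y hy hyq
    obtain ⟨b, hb⟩ := hy hyq.1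
    rcases le_or_gt b k with hbk | hbk
    · exact Or.inr ⟨hyq, mem_biUnion
        ((le_div_iff₀ (hq 0)).1 ((Nat.le_floor_iff (div_pos (hq _) (hq 0)).le).1 hbk)) hb⟩
    · refine Or.inl ⟨hyq, lt_of_le_of_lt ?_ (mem_branchMatrix_image_orthant_iff.1 hb).2.1⟩
      have := hyq.1 (Fin.last _)
      gcongr
      exact hbk
  refine ENNReal.le_of_add_le_add_left (a := 2⁻¹ * volume (corner q))
    (ENNReal.mul_ne_top (by simp) (volume_corner_ne_top hq)) ?_
  calc 2⁻¹ * volume (corner q) + 2⁻¹ * volume (corner q) = volume (corner q) := by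
        rw [← add_mul, ENNReal.inv_two_add_inv_two, one_mul]
    _ ≤ volume (corner q ∩ wild) + volume (corner q ∩ tame) :=
        (measure_mono_ae hcover).trans (measure_union_le _ _)
    _ ≤ 2⁻¹ * volume (corner q) + volume (corner q ∩ tame) := by gcongr

/-- Lebesgue measure on `corner 1`. Conic sets are compared through this finite measure. -/
noncomputable abbrev cornerMeasure (m : ℕ) : Measure (Fin (m + 2) → ℝ) :=
  volume.restrict (corner 1)

instance (m : ℕ) : IsFiniteMeasure (cornerMeasure m) :=
  isFiniteMeasure_restrict.2 (volume_corner_ne_top one_mem_orthant)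

theorem half_cornerMeasure_cylinder_le (w : List ℕ) :
    2⁻¹ * cornerMeasure m (cylinder m w) ≤ cornerMeasure m
      (⋃ b ∈ {b : ℕ | b * weight m w 0 ≤ weight m w (Fin.last _)}, cylinder m (b :: w)) := by
  have hW := isNonnegUnimodular_wordMatrix m w
  have hunion := image_iUnion₂ (wordMatrix m w).mulVec
    fun b (_ : b ∈ {b : ℕ | b * weight m w 0 ≤ weight m w (Fin.last _)}) =>
      (branchMatrix m b).mulVec '' orthant _
  simp only [cylinder_cons, ← hunion]
  rw [Measure.restrict_apply' (measurableSet_corner 1), Measure.restrict_apply'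
    (measurableSet_corner 1), inter_comm, inter_comm _ (corner 1), cylinder,
    hW.volume_corner_inter_image_orthant, hW.volume_corner_inter_image]
  · exact half_volume_corner_le (weight_pos m w)
  · exact iUnion₂_subset fun b _ y hy => (mem_branchMatrix_image_orthant_iff.1 hy).1

theorem pow_mul_cornerMeasure_cylinder_le (w : List ℕ) (k : ℕ) :
    2⁻¹ ^ k * cornerMeasure m (cylinder m w) ≤
      cornerMeasure m (⋃ u ∈ {u | IsTameExtension m w k u}, cylinder m u) := by
  induction k with
  | zero =>
    rw [pow_zero, one_mul]
    exact measure_mono (subset_biUnion_of_mem (u := cylinder m) IsTameExtension.refl)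
  | succ k ih =>
    set E := ⋃ u ∈ {u | IsTameExtension m w (k + 1) u}, cylinder m u
    have hE : MeasurableSet E := .biUnion (to_countable _) fun u _ => measurableSet_cylinder m u
    have hstep : ∀ v ∈ {v | IsTameExtension m w k v}, 2⁻¹ * cornerMeasure m (cylinder m v) ≤
        1 * cornerMeasure m (E ∩ cylinder m v) := fun v hv => by
      rw [one_mul]
      refine (half_cornerMeasure_cylinder_le v).trans (measure_mono (iUnion₂_subset fun b hb => ?_))
      exact subset_inter (subset_biUnion_of_mem (u := cylinder m) (IsTameExtension.cons hv hb))
        (antitone_cylinder m v b)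
    calc 2⁻¹ ^ (k + 1) * cornerMeasure m (cylinder m w)
        = 2⁻¹ * (2⁻¹ ^ k * cornerMeasure m (cylinder m w)) := by rw [pow_succ', mul_assoc]
      _ ≤ 2⁻¹ * cornerMeasure m (⋃ u ∈ {u | IsTameExtension m w k u}, cylinder m u) := by gcongr
      _ ≤ 1 * cornerMeasure m (E ∩ ⋃ u ∈ {u | IsTameExtension m w k u}, cylinder m u) :=
        mul_measure_biUnion_le (antitone_cylinder m) (disjoint_cylinder m)
          (measurableSet_cylinder m) hE hstep
      _ ≤ cornerMeasure m E := by
        rw [one_mul]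
        exact measure_mono inter_subset_left

theorem ae_exists_isBalanced_isPinching (m j : ℕ) :
    ∀ᵐ y ∂cornerMeasure m, ∃ u, IsBalanced m u ∧
      IsPinching (pinchRate m ^ (j + 1)) (wordMatrix m u) ∧ y ∈ cylinder m u := by
  set G := {u | IsBalanced m u ∧ IsPinching (pinchRate m ^ (j + 1)) (wordMatrix m u)}
  have hG : ∀ w, 2⁻¹ ^ ((j + 1) * (m + 1)) * cornerMeasure m (cylinder m w) ≤
      cornerMeasure m ((⋃ u ∈ G, cylinder m u) ∩ cylinder m w) := fun w => by
    refine (pow_mul_cornerMeasure_cylinder_le w _).trans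
      (measure_mono (iUnion₂_subset fun u hu => ?_))
    obtain ⟨v, -, hvu⟩ := IsTameExtension.exists_of_add (add_one_mul j (m + 1) ▸ hu)
    obtain ⟨x, -, rfl⟩ := IsTameExtension.exists_append hu
    exact subset_inter
      (subset_biUnion_of_mem (u := cylinder m) ⟨hvu.isBalanced, IsTameExtension.isPinching_pow hu⟩)
      (cantorScheme_append_subset (antitone_cylinder m) x w)
  have hcover := ae_exists_mem_of_forall_mul_le (antitone_cylinder m) (disjoint_cylinder m)
    (measurableSet_cylinder m) (fun w => ae_restrict_of_ae (ae_exists_mem_cylinder_cons m w))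
    (pow_ne_zero _ (by simp)) hG
  filter_upwards [hcover, ae_restrict_mem (measurableSet_corner 1)] with y hy hy1
  obtain ⟨u, hu, hyu⟩ := hy (by rw [cylinder_nil]; exact hy1.1)
  exact ⟨u, hu.1, hu.2, hyu⟩

end Branches

section Shape

/-! ### From homogeneous coordinates to the simplex -/

/-- The matrix of the linear change of coordinates `xᵢ = yᵢ + yᵢ₊₁ + ⋯`. -/
def tailMatrix (n : ℕ) : Matrix (Fin n) (Fin n) ℝ := of fun i j => if i ≤ j then 1 else 0

theorem isNonnegUnimodular_tailMatrix (n : ℕ) : IsNonnegUnimodular (tailMatrix n) where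
  nonneg i j := by
    rw [tailMatrix, of_apply]
    positivity
  abs_det := by
    rw [det_of_isUpperTriangular]
    · simp [tailMatrix]
    · intro i j (hij : j < i)
      simp [tailMatrix, hij.not_ge]

theorem tailMatrix_le_one {n : ℕ} (i : Fin n) : tailMatrix n i ≤ 1 := fun j => by
  rw [tailMatrix, of_apply, Pi.one_apply]
  split_ifs <;> norm_num

/-- The linear change of coordinates `xᵢ = yᵢ + yᵢ₊₁ + ⋯`. -/
def tailSum {n : ℕ} (y : Fin n → ℝ) : Fin n → ℝ := tailMatrix n *ᵥ y

variable {n m : ℕ}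

theorem tailSum_zero (y : Fin (n + 1) → ℝ) : tailSum y 0 = 1 ⬝ᵥ y :=
  congrArg (· ⬝ᵥ y) (funext fun j => by simp [tailMatrix])

theorem tailSum_last (y : Fin (n + 1) → ℝ) : tailSum y (Fin.last _) = y (Fin.last _) := by
  have hrow : tailMatrix (n + 1) (Fin.last _) = Pi.single (Fin.last _) 1 := by
    funext j
    simp [tailMatrix, Pi.single_apply, Fin.last_le_iff]
  rw [tailSum, mulVec, hrow, single_one_dotProduct]

theorem tailSum_castSucc (y : Fin (n + 1) → ℝ) (i : Fin n) :
    tailSum y i.castSucc = y i.castSucc + tailSum y i.succ := by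
  have hrow : tailMatrix (n + 1) i.castSucc =
      Pi.single i.castSucc 1 + tailMatrix (n + 1) i.succ := by
    funext j
    rcases lt_trichotomy j i.castSucc with h | rfl | h
    · simp [tailMatrix, h.ne, h.not_ge, (h.trans Fin.castSucc_lt_succ).not_ge]
    · simp [tailMatrix]
    · simp [tailMatrix, h.ne', h.le, Fin.castSucc_lt_iff_succ_le.1 h]
  rw [tailSum, mulVec, hrow, add_dotProduct, single_one_dotProduct]
  rfl

theorem tailSum_pos {y : Fin n → ℝ} (hy : y ∈ orthant _) (i : Fin n) : 0 < tailSum y i :=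
  (isNonnegUnimodular_tailMatrix n).mulVec_mem_orthant hy i

theorem antitone_tailSum_iff {y : Fin (n + 1) → ℝ} :
    Antitone (tailSum y) ↔ ∀ i : Fin n, 0 ≤ y i.castSucc := by
  simp [Fin.antitone_iff_succ_le, tailSum_castSucc]

theorem volume_tailSum_preimage (s : Set (Fin n → ℝ)) : volume (tailSum ⁻¹' s) = volume s := by
  have h := isNonnegUnimodular_tailMatrix n
  rw [← h.volume_image]
  exact congrArg volume (image_preimage_eq s (mulVec_surjective_iff_isUnit.2 h.isUnit))

/-- The point of the simplex represented by a vector of homogeneous coordinates. -/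
noncomputable def shape (y : Fin (n + 1) → ℝ) : Fin n → ℝ :=
  (tailSum y 0)⁻¹ • Fin.tail (tailSum y)

theorem shape_apply (y : Fin (n + 1) → ℝ) (i : Fin n) :
    shape y i = tailSum y i.succ / tailSum y 0 :=
  inv_mul_eq_div _ _

theorem measurable_shape : Measurable (shape : (Fin (n + 1) → ℝ) → Fin n → ℝ) := by
  have h : Measurable (tailSum : (Fin (n + 1) → ℝ) → _) :=
    (Continuous.matrix_mulVec continuous_const continuous_id).measurable
  simp only [measurable_pi_iff, shape_apply] at h ⊢
  exact fun i => (h _).div (h 0)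

theorem shape_smul {t : ℝ} (ht : 0 < t) (y : Fin (n + 1) → ℝ) : shape (t • y) = shape y := by
  funext i
  simp only [shape_apply, tailSum, mulVec_smul, Pi.smul_apply, smul_eq_mul]
  exact mul_div_mul_left _ _ ht.ne'

theorem shape_mem_simplex {y : Fin (n + 1) → ℝ} (hy : y ∈ orthant _) : shape y ∈ simplex n := by
  have h0 := tailSum_pos hy 0
  have hanti := antitone_tailSum_iff.2 fun i => (hy i.castSucc).le
  refine ⟨fun i => ?_, fun i j hij => ?_, fun i => ?_⟩
  · rw [shape_apply, div_le_one h0]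
    exact hanti (Fin.zero_le _)
  · rw [shape_apply, shape_apply]
    gcongr
    exact hanti (Fin.succ_le_succ_iff.2 hij)
  · rw [shape_apply]
    exact div_nonneg (tailSum_pos hy _).le h0.le

theorem nonneg_of_shape_mem_simplex {y : Fin (m + 2) → ℝ} (h0 : 0 < tailSum y 0)
    (hy : shape y ∈ simplex (m + 1)) : 0 ≤ y := by
  obtain ⟨hone, hanti, hnonneg⟩ := hy
  have hlast : 0 ≤ y (Fin.last _) := by
    have h := hnonneg (Fin.last m)
    rwa [shape_apply, Fin.succ_last, tailSum_last, le_div_iff₀ h0, zero_mul] at h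
  have hanti' : Antitone (tailSum y) := Fin.antitone_iff_succ_le.2 fun i => by
    induction i using Fin.cases with
    | zero => simpa [shape_apply, div_le_one h0] using hone 0
    | succ i =>
      have h := hanti (Fin.castSucc_lt_succ (i := i)).le
      rwa [shape_apply, shape_apply, div_le_div_iff_of_pos_right h0, Fin.succ_castSucc] at h
  exact fun i => i.lastCases hlast (antitone_tailSum_iff.1 hanti')

theorem IsPinching.dist_shape_le {ε : ℝ} {W : Matrix (Fin (n + 1)) (Fin (n + 1)) ℝ}
    (h : IsPinching ε W) (hε : 0 ≤ ε) (hW : IsNonnegUnimodular W) {y z : Fin (n + 1) → ℝ}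
    (hy : y ∈ W.mulVec '' orthant _) (hz : z ∈ W.mulVec '' orthant _) :
    dist (shape y) (shape z) ≤ ε := by
  refine (dist_pi_le_iff hε).2 fun i => ?_
  rw [Real.dist_eq, shape_apply, shape_apply, tailSum_zero, tailSum_zero]
  exact h.abs_div_sub_div_le hW ((isNonnegUnimodular_tailMatrix _).nonneg _) (tailMatrix_le_one _)
    hy hz

theorem lintegral_Ioo_pow (k : ℕ) :
    ∫⁻ t in Ioo (0 : ℝ) 1, ENNReal.ofReal (t ^ k) = ENNReal.ofReal (k + 1 : ℝ)⁻¹ := by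
  have hint : IntegrableOn (fun t : ℝ => t ^ k) (Ioo 0 1) :=
    (continuous_pow k).integrableOn_Icc.mono_set Ioo_subset_Icc_self
  rw [← ofReal_integral_eq_lintegral_ofReal hint
    ((ae_restrict_mem measurableSet_Ioo).mono fun t ht => pow_nonneg ht.1.le k),
    ← integral_Ioc_eq_integral_Ioo, ← intervalIntegral.integral_of_le zero_le_one, integral_pow]
  simp

theorem volume_cone {E : Set (Fin n → ℝ)} (hE : MeasurableSet E) :
    volume {x : Fin (n + 1) → ℝ | x 0 ∈ Ioo 0 1 ∧ (x 0)⁻¹ • Fin.tail x ∈ E} =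
      ENNReal.ofReal (n + 1 : ℝ)⁻¹ * volume E := by
  set S : Set (ℝ × (Fin n → ℝ)) := {p | p.1 ∈ Ioo 0 1 ∧ p.1⁻¹ • p.2 ∈ E}
  have hS : MeasurableSet S :=
    (measurable_fst measurableSet_Ioo).inter ((measurable_fst.inv.smul measurable_snd) hE)
  have hslice (t : ℝ) : volume (Prod.mk t ⁻¹' S) =
      (Ioo 0 1).indicator (fun t => ENNReal.ofReal (t ^ n) * volume E) t := by
    by_cases ht : t ∈ Ioo 0 1
    · have hsmul : Prod.mk t ⁻¹' S = t • E := by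
        ext x
        rw [mem_smul_set_iff_inv_smul_mem₀ ht.1.ne']
        exact and_iff_right ht
      rw [hsmul, Measure.addHaar_smul, Module.finrank_fintype_fun_eq_card, Fintype.card_fin,
        abs_of_pos (pow_pos ht.1 n), indicator_of_mem ht]
    · have hempty : Prod.mk t ⁻¹' S = ∅ := eq_empty_of_forall_notMem fun x hx => ht hx.1
      rw [indicator_of_notMem ht, hempty, measure_empty]
  calc volume {x : Fin (n + 1) → ℝ | x 0 ∈ Ioo 0 1 ∧ (x 0)⁻¹ • Fin.tail x ∈ E}
      = volume S := (volume_preserving_piFinSuccAbove (fun _ : Fin (n + 1) => ℝ) 0).measure_preimage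
        hS.nullMeasurableSet
    _ = ∫⁻ t in Ioo (0 : ℝ) 1, ENNReal.ofReal (t ^ n) * volume E := by
        rw [Measure.volume_eq_prod, Measure.prod_apply hS, lintegral_congr hslice,
          lintegral_indicator measurableSet_Ioo]
    _ = ENNReal.ofReal (n + 1 : ℝ)⁻¹ * volume E := by
        rw [lintegral_mul_const _ (by fun_prop), lintegral_Ioo_pow]

theorem cornerMeasure_shape_preimage {E : Set (Fin (m + 1) → ℝ)} (hE : MeasurableSet E)
    (hs : E ⊆ simplex (m + 1)) :
    cornerMeasure m (shape ⁻¹' E) = ENNReal.ofReal ((m + 1 : ℕ) + 1 : ℝ)⁻¹ * volume E := by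
  rw [← volume_cone hE, ← volume_tailSum_preimage,
    Measure.restrict_apply' (measurableSet_corner 1)]
  refine measure_congr (eventuallyEq_set.2 ?_)
  have hne : ∀ᵐ y : Fin (m + 2) → ℝ, ∀ i, y i ≠ 0 :=
    ae_all_iff.2 fun i => Measure.ae_eval_ne _ _ _
  filter_upwards [hne] with y hy
  constructor
  · rintro ⟨hyE, hyo, hy1⟩
    exact ⟨⟨tailSum_pos hyo 0, by rwa [tailSum_zero]⟩, hyE⟩
  · rintro ⟨⟨h0, h1⟩, hyE⟩
    rw [tailSum_zero] at h1
    exact ⟨hyE, fun i => (nonneg_of_shape_mem_simplex h0 (hs hyE) i).lt_of_ne' (hy i), h1⟩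

end Shape

section Ergodicity

/-! ### The triangle map in homogeneous coordinates -/

variable {m : ℕ}

theorem tailSum_branchMatrix_succ (b : ℕ) (y : Fin (m + 2) → ℝ) (i : Fin (m + 1)) :
    tailSum (branchMatrix m b *ᵥ y) i.succ = tailSum y i.castSucc := by
  induction i using Fin.reverseInduction with
  | last =>
    rw [Fin.succ_last, tailSum_last, branchMatrix_mulVec_last, tailSum_castSucc, Fin.succ_last,
      tailSum_last]
  | cast i ih =>
    rw [Fin.succ_castSucc, tailSum_castSucc, ih, ← Fin.succ_castSucc,
      branchMatrix_mulVec_castSucc_succ, tailSum_castSucc y i.castSucc, Fin.succ_castSucc]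

theorem tailSum_branchMatrix_zero (b : ℕ) (y : Fin (m + 2) → ℝ) :
    tailSum (branchMatrix m b *ᵥ y) 0 =
      tailSum y 0 + tailSum y (Fin.last _) + b * tailSum y (Fin.last m).castSucc := by
  have h := tailSum_castSucc (branchMatrix m b *ᵥ y) 0
  rw [tailSum_branchMatrix_succ, Fin.castSucc_zero] at h
  rw [h, branchMatrix_mulVec_zero, tailSum_last, tailSum_castSucc y (Fin.last m), Fin.succ_last,
    tailSum_last]
  ring

theorem shape_branchMatrix_apply (b : ℕ) (y : Fin (m + 2) → ℝ) (i : Fin (m + 1)) :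
    shape (branchMatrix m b *ᵥ y) i = tailSum y i.castSucc / tailSum (branchMatrix m b *ᵥ y) 0 := by
  rw [shape_apply, tailSum_branchMatrix_succ]

theorem one_sub_shape_branchMatrix {b : ℕ} {y : Fin (m + 2) → ℝ}
    (h0 : tailSum (branchMatrix m b *ᵥ y) 0 ≠ 0) :
    1 - shape (branchMatrix m b *ᵥ y) 0 - b * shape (branchMatrix m b *ᵥ y) (Fin.last m) =
      tailSum y (Fin.last _) / tailSum (branchMatrix m b *ᵥ y) 0 := by
  rw [shape_branchMatrix_apply, shape_branchMatrix_apply, Fin.castSucc_zero]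
  field_simp
  rw [tailSum_branchMatrix_zero]
  ring

theorem shape_branchMatrix_mem_piece {y : Fin (m + 2) → ℝ} (hy : y ∈ orthant _) (b : ℕ) :
    shape (branchMatrix m b *ᵥ y) ∈ piece m b := by
  have hb := (isNonnegUnimodular_branchMatrix m b).mulVec_mem_orthant hy
  have h0 := tailSum_pos hb 0
  have h := one_sub_shape_branchMatrix h0.ne'
  refine ⟨shape_mem_simplex hb, ?_, ?_⟩
  · rw [h]
    exact div_nonneg (tailSum_pos hy _).le h0.le
  · rw [add_mul, one_mul, ← sub_sub, h, shape_branchMatrix_apply, ← sub_div, tailSum_castSucc,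
      Fin.succ_last]
    exact div_neg_of_neg_of_pos (by linarith [hy (Fin.last m).castSucc]) h0

theorem branch_shape_branchMatrix {b : ℕ} {y : Fin (m + 2) → ℝ}
    (h0 : tailSum (branchMatrix m b *ᵥ y) 0 ≠ 0) :
    branch b (shape (branchMatrix m b *ᵥ y)) = shape y := by
  funext i
  induction i using Fin.lastCases with
  | last =>
    rw [branch, Fin.snoc_last, one_sub_shape_branchMatrix h0, shape_branchMatrix_apply,
      div_div_div_cancel_right₀ h0, shape_apply, Fin.succ_last, Fin.castSucc_zero]
  | cast i =>
    rw [branch, Fin.snoc_castSucc, shape_branchMatrix_apply, shape_branchMatrix_apply,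
      div_div_div_cancel_right₀ h0, shape_apply, Fin.succ_castSucc, Fin.castSucc_zero]

theorem triangleMap_eq_shape {b : ℕ} {y : Fin (m + 2) → ℝ} (hy : y ∈ orthant _)
    {x : simplex (m + 1)} (hx : x.1 = shape (branchMatrix m b *ᵥ y)) :
    (triangleMap m x).1 = shape y := by
  have hpiece := mem_piece_iff.1 (hx ▸ shape_branchMatrix_mem_piece hy b)
  have h0 := tailSum_pos ((isNonnegUnimodular_branchMatrix m b).mulVec_mem_orthant hy) 0
  rw [triangleMap, dif_neg hpiece.2.1]
  simp only [hpiece.2.2]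
  rw [hx, branch_shape_branchMatrix h0.ne']

theorem shape_branchMatrix_mem_image_preimage_iff {y : Fin (m + 2) → ℝ} (hy : y ∈ orthant _)
    (b : ℕ) {A : Set (simplex (m + 1))} :
    shape (branchMatrix m b *ᵥ y) ∈ Subtype.val '' (triangleMap m ⁻¹' A) ↔
      shape y ∈ Subtype.val '' A := by
  constructor
  · rintro ⟨x, hx, hxy⟩
    exact ⟨_, hx, triangleMap_eq_shape hy hxy⟩
  · rintro ⟨x, hx, hxy⟩
    have hmem := shape_mem_simplex ((isNonnegUnimodular_branchMatrix m b).mulVec_mem_orthant hy)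
    refine ⟨⟨_, hmem⟩, ?_, rfl⟩
    rwa [mem_preimage, Subtype.ext ((triangleMap_eq_shape hy rfl).trans hxy.symm)]

theorem shape_wordMatrix_mem_iff {F : Set (Fin (m + 1) → ℝ)}
    (hF : ∀ b, ∀ y ∈ orthant (Fin (m + 2)), shape (branchMatrix m b *ᵥ y) ∈ F ↔ shape y ∈ F)
    (w : List ℕ) {y : Fin (m + 2) → ℝ} (hy : y ∈ orthant _) :
    shape (wordMatrix m w *ᵥ y) ∈ F ↔ shape y ∈ F := by
  induction w generalizing y with
  | nil => rw [wordMatrix, one_mulVec]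
  | cons b w ih =>
    rw [wordMatrix, ← mulVec_mulVec,
      ih ((isNonnegUnimodular_branchMatrix m b).mulVec_mem_orthant hy), hF b y hy]

theorem measurableSet_simplex (n : ℕ) : MeasurableSet (simplex n) := by
  have h : simplex n = (⋂ i, {x | x i ≤ 1}) ∩
      ((⋂ i, ⋂ j, ⋂ _ : i ≤ j, {x | x j ≤ x i}) ∩ ⋂ i, {x | 0 ≤ x i}) := by
    ext x
    simp [simplex, Antitone]
  rw [h]
  refine (isClosed_iInter fun i => ?_).inter ((isClosed_iInter fun i => isClosed_iInter fun j =>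
    isClosed_iInter fun _ => ?_).inter (isClosed_iInter fun i => ?_)) |>.measurableSet
  · exact isClosed_le (continuous_apply i) continuous_const
  · exact isClosed_le (continuous_apply j) (continuous_apply i)
  · exact isClosed_le continuous_const (continuous_apply i)

theorem measurable_triangleMap (m : ℕ) : Measurable (triangleMap m) := by
  have hbranch : Measurable fun x : Fin (m + 1) → ℝ => branch (digit x) x := by
    refine measurable_pi_iff.2 fun i => ?_
    induction i using Fin.lastCases with
    | last =>
      simp only [branch, Fin.snoc_last, digit]
      have h : Measurable fun x : Fin (m + 1) → ℝ => (⌊(1 - x 0) / x (Fin.last m)⌋₊ : ℝ) :=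
        measurable_from_top.comp (Nat.measurable_floor.comp (by fun_prop))
      fun_prop
    | cast i =>
      simp only [branch, Fin.snoc_castSucc]
      fun_prop
  have hface : MeasurableSet {x : Fin (m + 1) → ℝ | x (Fin.last m) = 0} :=
    measurable_pi_apply _ (measurableSet_singleton 0)
  refine MeasurableEmbedding.subtype_coe (measurableSet_simplex _) |>.measurable_comp_iff.1 ?_
  classical
  have h : Subtype.val ∘ triangleMap m = (fun x : Fin (m + 1) → ℝ =>
      if x (Fin.last m) = 0 then 0 else branch (digit x) x) ∘ Subtype.val := by
    funext x
    simp only [Function.comp_apply, triangleMap]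
    split_ifs <;> rfl
  rw [h]
  exact (Measurable.ite hface measurable_const hbranch).comp measurable_subtype_coe

/-- Lebesgue measure on the simplex. -/
noncomputable abbrev simplexMeasure (m : ℕ) : Measure (simplex (m + 1)) :=
  Measure.comap (Subtype.val : simplex (m + 1) → (Fin (m + 1) → ℝ)) volume

theorem simplexMeasure_eq_zero_iff {A : Set (simplex (m + 1))} (hA : MeasurableSet A) :
    simplexMeasure m A = 0 ↔ cornerMeasure m (shape ⁻¹' (Subtype.val '' A)) = 0 := by
  rw [simplexMeasure, comap_subtype_coe_apply (measurableSet_simplex _),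
    cornerMeasure_shape_preimage ((measurableSet_simplex _).subtype_image hA)
      (Subtype.coe_image_subset _ _), mul_eq_zero, or_iff_right]
  exact (ENNReal.ofReal_pos.2 (by positivity)).ne'

theorem one_le_one_vecMul_branchMatrix (m b : ℕ) : 1 ≤ 1 ᵥ* branchMatrix m b := fun i => by
  have : (0 : ℝ) ≤ b := b.cast_nonneg
  induction i using Fin.lastCases with
  | last =>
    simp only [vecMul_branchMatrix_last, Pi.one_apply]
    linarith
  | cast i =>
    induction i using Fin.lastCases with
    | last =>
      simp only [vecMul_branchMatrix_castSucc_last, Pi.one_apply]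
      linarith
    | cast i => rw [vecMul_branchMatrix_castSucc_castSucc, Pi.one_apply, Pi.one_apply]

theorem ae_exists_mem_branchMatrix_image_corner (m : ℕ) :
    ∀ᵐ y ∂cornerMeasure m, ∃ b, y ∈ (branchMatrix m b).mulVec '' corner 1 := by
  filter_upwards [ae_restrict_of_ae (ae_exists_mem_branchMatrix_image m),
    ae_restrict_mem (measurableSet_corner 1)] with y hy hy1
  obtain ⟨b, z, hz, rfl⟩ := hy hy1.1
  refine ⟨b, z, corner_anti (one_le_one_vecMul_branchMatrix m b) ⟨hz, ?_⟩, rfl⟩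
  rw [← dotProduct_mulVec]
  exact hy1.2

theorem quasiMeasurePreserving_triangleMap (m : ℕ) :
    Measure.QuasiMeasurePreserving (triangleMap m) (simplexMeasure m) (simplexMeasure m) := by
  have hT := measurable_triangleMap m
  refine ⟨hT, Measure.AbsolutelyContinuous.mk fun A hA h0 => ?_⟩
  rw [Measure.map_apply hT hA, simplexMeasure_eq_zero_iff (hT hA)]
  rw [simplexMeasure_eq_zero_iff hA, Measure.restrict_apply' (measurableSet_corner 1)] at h0
  have hnull : volume (⋃ b, (branchMatrix m b).mulVec ''
      (shape ⁻¹' (Subtype.val '' A) ∩ corner 1)) = 0 :=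
    measure_iUnion_null fun b => by rw [(isNonnegUnimodular_branchMatrix m b).volume_image, h0]
  refine measure_mono_null_ae ?_ (Measure.restrict_le_self.absolutelyContinuous hnull)
  filter_upwards [ae_exists_mem_branchMatrix_image_corner m] with y hy hyA
  obtain ⟨b, z, hz, rfl⟩ := hy
  exact mem_iUnion.2
    ⟨b, z, ⟨(shape_branchMatrix_mem_image_preimage_iff hz.1 b).1 hyA, hz⟩, rfl⟩

theorem ae_exists_isBalanced_mapsTo_shape_ball (m : ℕ) :
    ∀ᵐ y ∂cornerMeasure m, ∀ ε > 0, ∃ w ∈ {w | IsBalanced m w}, y ∈ cylinder m w ∧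
      MapsTo shape (cylinder m w) (Metric.ball (shape y) ε) := by
  filter_upwards [ae_all_iff.2 (ae_exists_isBalanced_isPinching m)] with y hy ε hε
  obtain ⟨j, hj⟩ := exists_pow_lt_of_lt_one hε (pinchRate_lt_one m)
  have hnonneg := pinchRate_nonneg m
  obtain ⟨w, hbal, hpinch, hyw⟩ := hy j
  refine ⟨w, hbal, hyw, fun z hz => lt_of_le_of_lt ?_ hj⟩
  calc dist (shape z) (shape y)
      ≤ pinchRate m ^ (j + 1) :=
        hpinch.dist_shape_le (by positivity) (isNonnegUnimodular_wordMatrix m w) hz hyw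
    _ ≤ pinchRate m ^ j :=
        pow_le_pow_of_le_one hnonneg (pinchRate_lt_one m).le (Nat.le_succ j)

theorem cornerMeasure_shape_preimage_mul_cylinder_le {F : Set (Fin (m + 1) → ℝ)}
    (hF : ∀ b, ∀ y ∈ orthant (Fin (m + 2)), shape (branchMatrix m b *ᵥ y) ∈ F ↔ shape y ∈ F)
    {w : List ℕ} (hw : IsBalanced m w) :
    cornerMeasure m (shape ⁻¹' F) * cornerMeasure m (cylinder m w) ≤
      ENNReal.ofReal ((3 ^ (m + 1)) ^ (m + 2)) * volume (corner (1 : Fin (m + 2) → ℝ)) *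
        cornerMeasure m (shape ⁻¹' F ∩ cylinder m w) := by
  obtain ⟨t, ht, hlow, hup⟩ := hw
  have hconic : IsConic (shape ⁻¹' F) := fun t ht y => by
    rw [mem_preimage, mem_preimage, shape_smul ht]
  have h := (isNonnegUnimodular_wordMatrix m w).volume_corner_inter_le_of_balanced hconic
    (fun y hy => shape_wordMatrix_mem_iff hF w hy) ht (by positivity) hlow hup
  simp only [Measure.restrict_apply' (measurableSet_corner 1), inter_comm _ (corner 1)]
  rwa [Fintype.card_fin, inter_assoc] at h

theorem preErgodic_triangleMap (m : ℕ) : PreErgodic (triangleMap m) (simplexMeasure m) := by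
  refine ⟨fun A hA hinv => eventuallyConst_set'.2 ?_⟩
  have hF (b : ℕ) (y : Fin (m + 2) → ℝ) (hy : y ∈ orthant _) :
      shape (branchMatrix m b *ᵥ y) ∈ Subtype.val '' A ↔ shape y ∈ Subtype.val '' A := by
    simpa only [hinv] using shape_branchMatrix_mem_image_preimage_iff hy b (A := A)
  have hK : ENNReal.ofReal ((3 ^ (m + 1)) ^ (m + 2)) * volume (corner (1 : Fin (m + 2) → ℝ)) ≠ ∞ :=
    ENNReal.mul_ne_top ENNReal.ofReal_ne_top (volume_corner_ne_top one_mem_orthant)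
  rcases measure_preimage_eq_zero_or_compl (antitone_cylinder m) (disjoint_cylinder m)
    (measurableSet_cylinder m) measurable_shape ((measurableSet_simplex _).subtype_image hA) hK
    (fun w hw => cornerMeasure_shape_preimage_mul_cylinder_le hF hw)
    (ae_exists_isBalanced_mapsTo_shape_ball m) with h | h
  · exact Or.inl (ae_eq_empty.2 ((simplexMeasure_eq_zero_iff hA).2 h))
  · refine Or.inr (ae_eq_univ.2 ((simplexMeasure_eq_zero_iff hA.compl).2 (measure_mono_null ?_ h)))
    exact preimage_mono (image_compl_subset Subtype.val_injective)

end Ergodicity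

end TriangleMap

/-- In every dimension `m + 1 ≥ 1`, the triangle map is ergodic for Lebesgue measure on the
simplex (the restriction of `volume`, as a measure on the subtype). Lebesgue measure is not
invariant, so ergodicity is that of a map which is measurable and for which null sets have null
preimages: every measurable set `A` with `T⁻¹ A = A` is null or has null complement. -/
theorem mainTheorem1 (m : ℕ) :
    QuasiErgodic (TriangleMap.triangleMap m)
      (Measure.comap (Subtype.val : TriangleMap.simplex (m + 1) → (Fin (m + 1) → ℝ)) volume) :=
  ⟨TriangleMap.quasiMeasurePreserving_triangleMap m, TriangleMap.preErgodic_triangleMap m⟩
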